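/- Let $E$ be a finite-dimensional real normed space (for example $E=\mathbb R$ or $\mathbb R^{n-1}$), let $f:E\times\mathbb R\times\mathbb R\to E$ and $g:E\times\mathbb R\times\mathbb R\to\mathbb R$ be $C^\infty$ functions of $(x,y,u)$, and let $\phi:\mathbb R\to\mathbb R$ be a $C^\infty$ function with $\phi(w)=\operatorname{sign}(w)$ for $|w|>1$, $\phi(w)\in[-1,1]$ for $|w|\le1$, and $\phi'(w)>0$ for $|w|<1$. Let $M$ be such that, for all $x$ with $|x|\le M$, $$g(x,0,1)<0<g(x,0,-1)\quad\text{and}\quad \frac{\partial g}{\partial u}(x,0,u)<0\ \text{ for } u\in[-1,1].$$ Fix $T>0$ and let $x_U:[0,T]\to E$ be a solution of Utkin's equivalent control system $$\dot x=f(x,0,u),\qquad 0=g(x,0,u),\qquad u\in[-1,1],$$ with $|x_U(t)|<M$ for $0\le t\le T$. Then there exist $\kappa_0>0$ and $\alpha_0>0$ such that for every $\kappa<0$ with $|\kappa|\le\kappa_0$ and every $\delta_0$ with $0<\delta_0\le|\kappa|\alpha_0$ there exists a constant $L>0$ such that the following holds for every $\alpha<0$ with $|\alpha|\le\alpha_0$.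 Put $\varepsilon=\kappa\alpha>0$. For all $y_0,u_0\in\mathbb R$ with $|y_0|<|\alpha|$ and $\big||u_0|-1\big|<\delta_0$, the solution $(x(t),y(t),u(t))$ of $$\dot x=f(x,y,u),\qquad \dot y=g(x,y,u),\qquad \varepsilon\dot u=\phi\Big(\frac{y+\alpha u}{\varepsilon}\Big)-u,$$ with $(x(0),y(0),u(0))=(x_U(0),y_0,u_0)$ exists on $[0,T]$ and satisfies, for all $t\in[0,T]$, $$|x(t)-x_U(t)|<L|\alpha|,\qquad |y(t)|<L|\alpha|.$$ -/

import Mathlib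

open Set
open scoped ContDiff

/-- A smooth sigmoid `φ`: equal to `sign w` for `|w| > 1`, with values in `[-1, 1]` for `|w| ≤ 1`,
and with positive derivative for `|w| < 1`. -/
structure IsSmoothSwitch (φ : ℝ → ℝ) : Prop where
  smooth : ContDiff ℝ ∞ φ
  eq_sign : ∀ w : ℝ, 1 < |w| → φ w = Real.sign w
  mem_Icc : ∀ w : ℝ, |w| ≤ 1 → φ w ∈ Icc (-1 : ℝ) 1
  deriv_pos : ∀ w : ℝ, |w| < 1 → 0 < deriv φ w

/-- On the part `‖x‖ ≤ M` of the switching surface `y = 0`, the flow is directed towards the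
surface from both sides, and `g(x, 0; u)` is strictly decreasing in the switching quantity
`u ∈ [-1, 1]`, with negative `u`-derivative. -/
def IsAttractingSwitch {E : Type*} [NormedAddCommGroup E] (g : E → ℝ → ℝ → ℝ) (M : ℝ) : Prop :=
  ∀ x : E, ‖x‖ ≤ M →
    g x 0 1 < 0 ∧ 0 < g x 0 (-1) ∧ ∀ u ∈ Icc (-1 : ℝ) 1, deriv (fun s : ℝ => g x 0 s) u < 0

/-- `x` solves Utkin's equivalent control along `y = 0` on the time interval `[0, T]`:
`ẋ = f(x, 0; u)`, `0 = g(x, 0; u)` with `u ∈ [-1, 1]`. -/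
def IsUtkinSolution {E : Type*} [NormedAddCommGroup E] [NormedSpace ℝ E]
    (f : E → ℝ → ℝ → E) (g : E → ℝ → ℝ → ℝ) (T : ℝ) (x : ℝ → E) : Prop :=
  ∀ t ∈ Icc (0 : ℝ) T, ∃ u ∈ Icc (-1 : ℝ) 1,
    g (x t) 0 u = 0 ∧ HasDerivWithinAt x (f (x t) 0 u) (Icc 0 T) t

/-- `(x, y, u)` solves, on the time interval `[0, T]`, the slow-fast system
`ẋ = f(x, y; u)`, `ẏ = g(x, y; u)`, `ε u̇ = φ((y + α u) / ε) - u` (for `ε ≠ 0`). -/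
structure IsSlowFastSolution {E : Type*} [NormedAddCommGroup E] [NormedSpace ℝ E]
    (f : E → ℝ → ℝ → E) (g : E → ℝ → ℝ → ℝ) (φ : ℝ → ℝ) (α ε T : ℝ)
    (x : ℝ → E) (y u : ℝ → ℝ) : Prop where
  hasDeriv_x : ∀ t ∈ Icc (0 : ℝ) T,
    HasDerivWithinAt x (f (x t) (y t) (u t)) (Icc 0 T) t
  hasDeriv_y : ∀ t ∈ Icc (0 : ℝ) T,
    HasDerivWithinAt y (g (x t) (y t) (u t)) (Icc 0 T) t
  hasDeriv_u : ∀ t ∈ Icc (0 : ℝ) T,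
    HasDerivWithinAt u ((φ ((y t + α * u t) / ε) - u t) / ε) (Icc 0 T) t

/-! Write α = -a, κ = -k, so ε = ka. Let U be the control along `xU`, W its preimage under φ, and
put h₁ = u - U, h₂ = y/a - u - kW. The argument of φ is W + h₂/k, so p = φ(W + h₂/k) - φ(W) has the
sign of h₂, and formally h₁' = (p - h₁)/(ka) - U', h₂' = g/a + h₁/(ka) - p/(ka) - kW'. In the growth
of |h₁| + |h₂| the terms ±|p|/(ka) cancel. Since g(xU, 0, ·) decreases at rate at least γ and
vanishes at U, |h₁ + kg(xU, 0, u)| ≤ (1 - kγ)|h₁| for small k. So the terms ±|h₁|/(ka) cancel too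
and leave -γ|h₁|/a, which pays for the u-dependence of f once ‖x - xU‖/a is added with weight γ/Lf.
What remains is affine growth with constants free of k and a (`eventually_lyapunov_le`); a Gronwall
argument bounds the sum, hence x - xU and y are O(a) (`apriori_bound`).

Absolute values are not differentiable and U, W are only Lipschitz, so the estimate is made on
forward Euler steps and propagated by continuous induction. The Lipschitz bounds come from strict
monotonicity of g in u and from |U| ≤ b < 1 (`exists_isSlidingReference`). Existence comes from a
cut-off field, whose solution the same bound confines to the box where nothing was changed. -/

open Filter Topology

/-! ### Forward Euler steps for absolute values. -/

/-- The increment of a function differentiable from the right is, up to an arbitrarily small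
multiple of the step, given by its derivative. -/
theorem HasDerivWithinAt.eventually_norm_sub_le {F : Type*} [NormedAddCommGroup F]
    [NormedSpace ℝ F] {x : ℝ → F} {x' : F} {T t r : ℝ}
    (h : HasDerivWithinAt x x' (Icc 0 T) t) (ht : t ∈ Ico 0 T) (hr : 0 < r) :
    ∀ᶠ z in 𝓝[>] t, ‖x z - x t - (z - t) • x'‖ ≤ r * (z - t) := by
  have h1 := (hasDerivWithinAt_iff_isLittleO.1 h).def hr
  have hle : 𝓝[>] t ≤ 𝓝[Icc 0 T] t := by
    rw [nhdsWithin_le_iff]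
    filter_upwards [Ioc_mem_nhdsGT ht.2] with z hz
    exact ⟨ht.1.trans hz.1.le, hz.2⟩
  filter_upwards [hle h1, self_mem_nhdsWithin] with z hz hzt
  rwa [Real.norm_of_nonneg (sub_nonneg.2 (le_of_lt hzt))] at hz

/-- One explicit Euler step of `k a h₁' = p - h₁`, perturbed by `e`. -/
theorem abs_le_of_relaxation_step {h h' p s q e : ℝ} (hs : 0 ≤ s) (hq : 0 < q) (hsq : s ≤ q)
    (he : |h' - (h + s * ((p - h) / q))| ≤ e) :
    |h'| ≤ |h| - s * (|h| / q) + s * (|p| / q) + e := by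
  have hθ : 0 ≤ 1 - s / q := by rw [sub_nonneg, div_le_one hq]; exact hsq
  have e1 : h' = (h' - (h + s * ((p - h) / q))) + ((1 - s / q) * h + s / q * p) := by
    field_simp; ring
  have h2 : |(1 - s / q) * h + s / q * p| ≤ (1 - s / q) * |h| + s / q * |p| := by
    refine (abs_add_le _ _).trans ?_
    rw [abs_mul, abs_mul, abs_of_nonneg hθ, abs_of_nonneg (div_nonneg hs hq.le)]
  have h3 := abs_add_le (h' - (h + s * ((p - h) / q))) ((1 - s / q) * h + s / q * p)
  rw [← e1] at h3
  calc |h'| ≤ e + ((1 - s / q) * |h| + s / q * |p|) := by linarith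
    _ = _ := by field_simp; ring

/-- One explicit Euler step towards the origin, with forcing `c` and perturbation `e`. -/
theorem abs_le_of_damped_step {h h' p s q c e : ℝ} (hs : 0 ≤ s) (hq : 0 < q)
    (hp : 0 ≤ p * h) (hsp : s * (|p| / q) ≤ |h|)
    (he : |h' - (h + s * (c - p / q))| ≤ e) :
    |h'| ≤ |h| - s * (|p| / q) + s * |c| + e := by
  -- By `hsp` the step does not overshoot the origin, so the pull is gained in full.
  have h1 : |h - s * (p / q)| = |h| - s * (|p| / q) := by
    rcases lt_trichotomy h 0 with hh | hh | hh
    · have : p ≤ 0 := by nlinarith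
      rw [abs_of_neg hh] at *
      rw [abs_of_nonpos this] at *
      rw [abs_of_nonpos]
      · ring
      · have : -p / q = -(p / q) := by ring
        rw [this] at hsp; linarith
    · subst hh
      simp only [abs_zero] at *
      have : s * (|p| / q) = 0 := le_antisymm hsp (by positivity)
      rw [this, zero_sub, abs_neg, abs_mul, abs_div, abs_of_nonneg hs, abs_of_pos hq, this]
      simp
    · have : 0 ≤ p := by nlinarith
      rw [abs_of_pos hh] at *
      rw [abs_of_nonneg this] at *
      rw [abs_of_nonneg]
      linarith
  have e1 : h' = (h' - (h + s * (c - p / q))) + ((h - s * (p / q)) + s * c) := by ring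
  have h3 := abs_add_le (h' - (h + s * (c - p / q))) ((h - s * (p / q)) + s * c)
  have h4 := abs_add_le (h - s * (p / q)) (s * c)
  rw [← e1] at h3
  rw [h1, abs_mul s c, abs_of_nonneg hs] at h4
  linarith

theorem continuousOn_of_abs_sub_le {V : ℝ → ℝ} {S : Set ℝ} {D : ℝ}
    (hV : ∀ s ∈ S, ∀ t ∈ S, |V s - V t| ≤ D * |s - t|) : ContinuousOn V S :=
  (LipschitzOnWith.of_dist_le' hV).continuousOn

/-! ### The sliding reference and growth of the Lyapunov function. -/

/-- The data along the sliding trajectory `xU` that control nearby solutions of the slow-fast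
system: the equivalent control `U`, its preimage `W` under the switch, and Lipschitz and
contraction constants on the region `‖x‖ ≤ R`, `|y| ≤ 1`, `|u| ≤ 1 + δ`. -/
structure IsSlidingReference {E : Type*} [NormedAddCommGroup E] [NormedSpace ℝ E]
    (f : E → ℝ → ℝ → E) (g : E → ℝ → ℝ → ℝ) (φ : ℝ → ℝ) (T R δ γ Lf Lg D : ℝ)
    (xU : ℝ → E) (U W : ℝ → ℝ) : Prop where
  mono : Monotone φ
  abs_switch_le : ∀ w, |φ w| ≤ 1
  gamma_pos : 0 < γ
  Lf_pos : 0 < Lf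
  Lg_pos : 0 < Lg
  D_nonneg : 0 ≤ D
  norm_add_one_le : ∀ t ∈ Icc 0 T, ‖xU t‖ + 1 ≤ R
  hasDeriv : ∀ t ∈ Icc 0 T, HasDerivWithinAt xU (f (xU t) 0 (U t)) (Icc 0 T) t
  abs_U_le : ∀ t ∈ Icc 0 T, |U t| ≤ 1
  abs_W_le : ∀ t ∈ Icc 0 T, |W t| ≤ 1
  switch_W : ∀ t ∈ Icc 0 T, φ (W t) = U t
  lip_U : ∀ s ∈ Icc 0 T, ∀ t ∈ Icc 0 T, |U s - U t| ≤ D * |s - t|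
  lip_W : ∀ s ∈ Icc 0 T, ∀ t ∈ Icc 0 T, |W s - W t| ≤ D * |s - t|
  lip_f : ∀ t ∈ Icc 0 T, ∀ x y u, ‖x‖ ≤ R → |y| ≤ 1 → |u| ≤ 1 + δ →
    ‖f x y u - f (xU t) 0 (U t)‖ ≤ Lf * (‖x - xU t‖ + |y| + |u - U t|)
  lip_g : ∀ t ∈ Icc 0 T, ∀ x y u, ‖x‖ ≤ R → |y| ≤ 1 → |u| ≤ 1 + δ →
    |g x y u - g (xU t) 0 u| ≤ Lg * (‖x - xU t‖ + |y|)
  contract : ∀ t ∈ Icc 0 T, ∀ u, |u| ≤ 1 + δ → ∀ k, 0 < k → k * Lg ≤ 1 →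
    |u - U t + k * g (xU t) 0 u| ≤ (1 - k * γ) * |u - U t|

/-- The weighted distance of `(x, y, u)` to the sliding reference. -/
noncomputable def slidingLyapunov {E : Type*} [NormedAddCommGroup E] (k a θ : ℝ)
    (xU : ℝ → E) (U W : ℝ → ℝ) (x : ℝ → E) (y u : ℝ → ℝ) (t : ℝ) : ℝ :=
  |u t - U t| + |y t / a - u t - k * W t| + θ / a * ‖x t - xU t‖

section

variable {E : Type*} [NormedAddCommGroup E] [NormedSpace ℝ E]
    {f : E → ℝ → ℝ → E} {g : E → ℝ → ℝ → ℝ} {φ : ℝ → ℝ} {T R δ γ Lf Lg D k a : ℝ}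
    {xU : ℝ → E} {U W : ℝ → ℝ} {x : ℝ → E} {y u : ℝ → ℝ} {t : ℝ}

/-- The rescaled distance to the switching surface is bounded by the Lyapunov function. -/
theorem IsSlidingReference.abs_div_le (h : IsSlidingReference f g φ T R δ γ Lf Lg D xU U W)
    (ht : t ∈ Icc 0 T) (hk : 0 < k) (hk1 : k ≤ 1) (ha : 0 < a) :
    |y t| / a ≤ slidingLyapunov k a (γ / Lf) xU U W x y u t + 2 := by
  have h0 : 0 ≤ γ / Lf / a * ‖x t - xU t‖ := by
    have := h.gamma_pos; have := h.Lf_pos; positivity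
  have h1 : |y t| / a = |(y t / a - u t - k * W t) + (u t - U t) + (U t + k * W t)| := by
    rw [← abs_of_pos ha, ← abs_div, abs_of_pos ha]; congr 1; ring
  have h2 := abs_add_le (y t / a - u t - k * W t + (u t - U t)) (U t + k * W t)
  have h3 := abs_add_le (y t / a - u t - k * W t) (u t - U t)
  have h4 := abs_add_le (U t) (k * W t)
  have h5 := h.abs_U_le t ht
  have h6 : |k * W t| ≤ 1 := by
    rw [abs_mul, abs_of_pos hk]
    exact mul_le_one₀ hk1 (abs_nonneg _) (h.abs_W_le t ht)
  unfold slidingLyapunov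
  linarith

/-- Only the third term of the Lyapunov function is used; the factor 1/a turns a bound uniform in a
into an O(a) error. -/
theorem IsSlidingReference.norm_sub_div_le (h : IsSlidingReference f g φ T R δ γ Lf Lg D xU U W)
    (ha : 0 < a) :
    ‖x t - xU t‖ / a ≤ Lf / γ * slidingLyapunov k a (γ / Lf) xU U W x y u t := by
  have hγ := h.gamma_pos
  have hLf := h.Lf_pos
  have : ‖x t - xU t‖ / a = Lf / γ * (γ / Lf / a * ‖x t - xU t‖) := by field_simp
  rw [this]
  unfold slidingLyapunov
  gcongr
  have := abs_nonneg (u t - U t)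
  have := abs_nonneg (y t / a - u t - k * W t)
  linarith

set_option maxHeartbeats 400000 in
/-- The one-sided growth rate of the Lyapunov function along the slow-fast system is at most
affine, uniformly in `k` and `a`. -/
theorem IsSlidingReference.eventually_lyapunov_le
    (h : IsSlidingReference f g φ T R δ γ Lf Lg D xU U W)
    (hk : 0 < k) (hk1 : k ≤ 1) (hkL : k * Lg ≤ 1) (ha : 0 < a) (ht : t ∈ Ico 0 T)
    (hxR : ‖x t‖ ≤ R) (hy1 : |y t| ≤ 1) (hu1 : |u t| ≤ 1 + δ)
    (hx : HasDerivWithinAt x (f (x t) (y t) (u t)) (Icc 0 T) t)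
    (hy : HasDerivWithinAt y (g (x t) (y t) (u t)) (Icc 0 T) t)
    (hu : HasDerivWithinAt u ((φ ((y t - a * u t) / (k * a)) - u t) / (k * a)) (Icc 0 T) t) :
    ∀ᶠ z in 𝓝[>] t, slidingLyapunov k a (γ / Lf) xU U W x y u z ≤
      slidingLyapunov k a (γ / Lf) xU U W x y u t + (z - t) *
        ((2 * D + (Lg + γ) * (Lf / γ + 2)) *
          (1 + slidingLyapunov k a (γ / Lf) xU U W x y u t) + 1) := by
  have hγ := h.gamma_pos
  have hLf := h.Lf_pos
  have hLg := h.Lg_pos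
  have hD := h.D_nonneg
  have ht' : t ∈ Icc 0 T := Ico_subset_Icc_self ht
  have hYle := h.abs_div_le (x := x) (y := y) (u := u) ht' hk hk1 ha
  have hXle := h.norm_sub_div_le (x := x) (y := y) (u := u) (W := W) (k := k) (t := t) ha
  have hq : 0 < k * a := mul_pos hk ha
  -- Chosen so that all Euler errors together cost exactly one unit of growth.
  set r : ℝ := 1 / (2 + 1 / a + 2 * (γ / Lf / a)) with hr
  have hden : 0 < 2 + 1 / a + 2 * (γ / Lf / a) := by positivity
  have hr0 : 0 < r := by positivity
  have hrsum : r * (2 + 1 / a + 2 * (γ / Lf / a)) = 1 := by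
    rw [hr]; field_simp
  set h1 := u t - U t with hh1
  set h2 := y t / a - u t - k * W t with hh2
  set p := φ ((y t - a * u t) / (k * a)) - U t with hp
  have hph : 0 ≤ p * h2 := by
    have hw : (y t - a * u t) / (k * a) - W t = h2 / k := by rw [hh2]; field_simp
    rw [hp, ← h.switch_W t ht']
    rcases le_total 0 h2 with h0 | h0
    · have : W t ≤ (y t - a * u t) / (k * a) := by
        have := div_nonneg h0 hk.le; linarith
      exact mul_nonneg (sub_nonneg.2 (h.mono this)) h0
    · have : (y t - a * u t) / (k * a) ≤ W t := by
        have := div_nonpos_of_nonpos_of_nonneg h0 hk.le; linarith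
      exact mul_nonneg_of_nonpos_of_nonpos (sub_nonpos.2 (h.mono this)) h0
  -- Without this, no step, however short, would avoid overshooting when h₂ = 0.
  have hp0 : h2 = 0 → p = 0 := by
    intro h0
    have hw : (y t - a * u t) / (k * a) = W t := by
      have : (y t - a * u t) / (k * a) - W t = h2 / k := by rw [hh2]; field_simp
      rw [h0, zero_div] at this; linarith
    rw [hp, hw, h.switch_W t ht', sub_self]
  have hsub : Tendsto (fun z => z - t) (𝓝[>] t) (𝓝 0) := by
    have : Tendsto (fun z => z - t) (𝓝 t) (𝓝 (t - t)) := (continuous_id.sub continuous_const).tendsto t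
    rw [sub_self] at this
    exact this.mono_left nhdsWithin_le_nhds
  have hsmall : ∀ᶠ z in 𝓝[>] t, (z - t) * (|p| / (k * a)) ≤ |h2| := by
    by_cases h0 : h2 = 0
    · simp [h0, hp0 h0]
    · have := hsub.mul_const (|p| / (k * a))
      rw [zero_mul] at this
      exact (this.eventually (eventually_lt_nhds (abs_pos.2 h0))).mono fun _ => le_of_lt
  have hUt : ∀ᶠ z in 𝓝[>] t, z ∈ Icc 0 T := by
    filter_upwards [Ioc_mem_nhdsGT ht.2] with z hz
    exact ⟨ht.1.trans hz.1.le, hz.2⟩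
  filter_upwards [hsmall, hsub.eventually (eventually_lt_nhds hq), self_mem_nhdsWithin, hUt,
    hx.eventually_norm_sub_le ht hr0, hy.eventually_norm_sub_le ht hr0,
    hu.eventually_norm_sub_le ht hr0, (h.hasDeriv t ht').eventually_norm_sub_le ht hr0]
    with z hsm hzq hzt hz hxz hyz huz hxUz
  have hs : 0 ≤ z - t := sub_nonneg.2 (le_of_lt hzt)
  set s := z - t with hsdef
  have hUz := h.lip_U z hz t ht'
  have hWz := h.lip_W z hz t ht'
  rw [← hsdef, abs_of_nonneg hs] at hUz hWz
  rw [Real.norm_eq_abs, smul_eq_mul] at hyz huz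
  -- the fast variable
  have A : |u z - U z| ≤ |h1| - s * (|h1| / (k * a)) + s * (|p| / (k * a)) + (r * s + D * s) := by
    refine abs_le_of_relaxation_step hs hq hzq.le ?_
    have e : u z - U z - (h1 + s * ((p - h1) / (k * a))) =
        (u z - u t - s * ((φ ((y t - a * u t) / (k * a)) - u t) / (k * a))) - (U z - U t) := by
      rw [hh1, hp]; ring
    rw [e]
    exact (abs_sub _ _).trans (add_le_add huz hUz)
  -- the rescaled distance to the switching surface
  have B : |y z / a - u z - k * W z| ≤ |h2| - s * (|p| / (k * a)) +
      s * |g (x t) (y t) (u t) / a + h1 / (k * a)| + (r * s / a + r * s + D * s) := by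
    refine abs_le_of_damped_step hs hq hph hsm ?_
    have e : y z / a - u z - k * W z -
        (h2 + s * (g (x t) (y t) (u t) / a + h1 / (k * a) - p / (k * a))) =
        (y z - y t - s * g (x t) (y t) (u t)) / a -
        (u z - u t - s * ((φ ((y t - a * u t) / (k * a)) - u t) / (k * a))) -
        k * (W z - W t) := by
      rw [hh1, hh2, hp]; ring
    rw [e]
    refine (abs_sub _ _).trans (add_le_add ((abs_sub _ _).trans (add_le_add ?_ huz)) ?_)
    · rw [abs_div, abs_of_pos ha]; gcongr
    · rw [abs_mul, abs_of_pos hk]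
      calc k * |W z - W t| ≤ 1 * (D * s) := by gcongr
        _ = D * s := one_mul _
  -- The contraction turns h₁/(ka), singular in k, into a term that the relaxation of u absorbs,
  -- with γ|h₁|/a to spare.
  have C : |g (x t) (y t) (u t) / a + h1 / (k * a)| ≤
      |h1| / (k * a) - γ * |h1| / a + Lg * (‖x t - xU t‖ / a + |y t| / a) := by
    have e : g (x t) (y t) (u t) / a + h1 / (k * a) =
        (h1 + k * g (xU t) 0 (u t)) / (k * a) +
          (g (x t) (y t) (u t) - g (xU t) 0 (u t)) / a := by field_simp; ring
    rw [e]
    refine (abs_add_le _ _).trans ?_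
    rw [abs_div, abs_div, abs_of_pos hq, abs_of_pos ha]
    have c1 := h.contract t ht' (u t) hu1 k hk hkL
    have c2 := h.lip_g t ht' (x t) (y t) (u t) hxR hy1 hu1
    calc _ ≤ (1 - k * γ) * |h1| / (k * a) + Lg * (‖x t - xU t‖ + |y t|) / a := by gcongr
      _ = _ := by field_simp
  -- The weight γ/Lf makes the cost of |h₁| here exactly the spare γ|h₁|/a.
  have X : γ / Lf / a * ‖x z - xU z‖ ≤ γ / Lf / a * ‖x t - xU t‖ +
      s * (γ * (‖x t - xU t‖ / a + |y t| / a) + γ * |h1| / a) +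
      r * (2 * (γ / Lf / a)) * s := by
    have c3 := h.lip_f t ht' (x t) (y t) (u t) hxR hy1 hu1
    have e : x z - xU z = (x t - xU t) +
        (s • (f (x t) (y t) (u t) - f (xU t) 0 (U t)) +
        ((x z - x t - s • f (x t) (y t) (u t)) -
          (xU z - xU t - s • f (xU t) 0 (U t)))) := by
      rw [smul_sub]; abel
    have n1 : ‖x z - xU z‖ ≤ ‖x t - xU t‖ +
        (s * (Lf * (‖x t - xU t‖ + |y t| + |h1|)) + (r * s + r * s)) := by
      rw [e]
      refine (norm_add_le _ _).trans (add_le_add le_rfl ((norm_add_le _ _).trans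
        (add_le_add ?_ ((_root_.norm_sub_le _ _).trans (add_le_add hxz hxUz)))))
      rw [norm_smul, Real.norm_of_nonneg hs]
      gcongr
    calc _ ≤ γ / Lf / a * (‖x t - xU t‖ +
        (s * (Lf * (‖x t - xU t‖ + |y t| + |h1|)) + (r * s + r * s))) := by gcongr
      _ = _ := by field_simp; ring
  have C' := mul_le_mul_of_nonneg_left C hs
  have hZ0 : 0 ≤ slidingLyapunov k a (γ / Lf) xU U W x y u t := by
    unfold slidingLyapunov; positivity
  set Z := slidingLyapunov k a (γ / Lf) xU U W x y u t with hZ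
  have hZt : Z = |h1| + |h2| + γ / Lf / a * ‖x t - xU t‖ := rfl
  have total : slidingLyapunov k a (γ / Lf) xU U W x y u z ≤
      Z + s * (2 * D + (Lg + γ) * (‖x t - xU t‖ / a + |y t| / a) +
        r * (2 + 1 / a + 2 * (γ / Lf / a))) := by
    rw [hZt]
    unfold slidingLyapunov
    calc _ ≤ _ := add_le_add (add_le_add A (B.trans
            (add_le_add (add_le_add le_rfl C') le_rfl))) X
      _ = _ := by ring
  refine total.trans ?_
  rw [hrsum]
  have : (Lg + γ) * (‖x t - xU t‖ / a + |y t| / a) ≤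
      (Lg + γ) * ((Lf / γ + 2) * (1 + Z)) := by
    refine mul_le_mul_of_nonneg_left ?_ (by positivity)
    have : 0 ≤ Lf / γ := by positivity
    calc _ ≤ Lf / γ * Z + (Z + 2) := add_le_add hXle hYle
      _ ≤ Lf / γ * Z + (Z + 2) + (Lf / γ + Z) := le_add_of_nonneg_right (by positivity)
      _ = _ := by ring
  have h2D : 2 * D ≤ 2 * D * (1 + Z) :=
    le_mul_of_one_le_right (by positivity) (by simpa using hZ0)
  refine add_le_add le_rfl (mul_le_mul_of_nonneg_left ?_ hs)
  calc _ ≤ 2 * D * (1 + Z) + (Lg + γ) * ((Lf / γ + 2) * (1 + Z)) + 1 :=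
        add_le_add (add_le_add h2D this) le_rfl
    _ = _ := by ring

end

/-! ### The a priori bound by continuous induction. -/

section

variable {E : Type*} [NormedAddCommGroup E] [NormedSpace ℝ E]
    {f : E → ℝ → ℝ → E} {g : E → ℝ → ℝ → ℝ} {φ : ℝ → ℝ} {T R δ γ Lf Lg D k a : ℝ}
    {xU : ℝ → E} {U W : ℝ → ℝ} {x : ℝ → E} {y u : ℝ → ℝ}

/-- The interval `|u| ≤ 1 + δ` is invariant for the control equation. -/
theorem eventually_abs_le_of_hasDerivWithinAt {v q t : ℝ} (hv : |v| ≤ 1) (hδ : 0 < δ) (hq : 0 < q)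
    (ht : t ∈ Ico 0 T) (hu1 : |u t| ≤ 1 + δ)
    (hu : HasDerivWithinAt u ((v - u t) / q) (Icc 0 T) t) :
    ∀ᶠ z in 𝓝[>] t, |u z| ≤ 1 + δ := by
  -- At |u| = 1 + δ the inward speed is at least δ/q, which absorbs this Euler error.
  have hr : 0 < δ / q := div_pos hδ hq
  have hz : ∀ᶠ z in 𝓝[>] t, z < t + q :=
    (eventually_lt_nhds (by linarith)).filter_mono nhdsWithin_le_nhds
  filter_upwards [hu.eventually_norm_sub_le ht hr, self_mem_nhdsWithin, hz] with z h1 h2 h3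
  have hs : 0 ≤ z - t := sub_nonneg.2 (le_of_lt h2)
  have h4 := abs_le_of_relaxation_step (h := u t) (h' := u z) (p := v) hs hq (by linarith)
    (e := δ / q * (z - t)) (by
      rw [Real.norm_eq_abs, smul_eq_mul] at h1
      rwa [← sub_sub])
  have hθ : 0 ≤ 1 - (z - t) / q := by rw [sub_nonneg, div_le_one hq]; linarith
  calc |u z| ≤ |u t| - (z - t) * (|u t| / q) + (z - t) * (|v| / q) + δ / q * (z - t) := h4
    _ = (1 - (z - t) / q) * |u t| + (z - t) / q * |v| + δ / q * (z - t) := by ring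
    _ ≤ (1 - (z - t) / q) * (1 + δ) + (z - t) / q * 1 + δ / q * (z - t) := by gcongr
    _ = 1 + δ := by ring

/-- Solutions that start close to the switching surface stay `O(a)`-close to the sliding
trajectory. The differential equation is only required where the solution lies in the box
`‖x‖ ≤ R`, `|y| ≤ 1`, `|u| ≤ 1 + δ`. -/
theorem IsSlidingReference.apriori_bound
    (h : IsSlidingReference f g φ T R δ γ Lf Lg D xU U W) (hT : 0 < T) (hδ : 0 < δ) (hδ1 : δ ≤ 1)
    (hk : 0 < k) (hk1 : k ≤ 1) (hkL : k * Lg ≤ 1) (ha : 0 < a) {K : ℝ}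
    (hK : K = 8 * Real.exp ((2 * D + (Lg + γ) * (Lf / γ + 2) + 1) * T))
    (ha1 : a * (K + 2) ≤ 1) (ha2 : a * (Lf / γ * K) ≤ 1)
    (hxc : ContinuousOn x (Icc 0 T)) (hyc : ContinuousOn y (Icc 0 T))
    (huc : ContinuousOn u (Icc 0 T))
    (hode : ∀ t ∈ Ico 0 T, ‖x t‖ ≤ R → |y t| ≤ 1 → |u t| ≤ 1 + δ →
      HasDerivWithinAt x (f (x t) (y t) (u t)) (Icc 0 T) t ∧
      HasDerivWithinAt y (g (x t) (y t) (u t)) (Icc 0 T) t ∧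
      HasDerivWithinAt u ((φ ((y t - a * u t) / (k * a)) - u t) / (k * a)) (Icc 0 T) t)
    (hx0 : x 0 = xU 0) (hy0 : |y 0| < a) (hu0 : |u 0| ≤ 1 + δ) :
    ∀ t ∈ Icc 0 T, ‖x t - xU t‖ ≤ a * (Lf / γ * K) ∧ |y t| ≤ a * (K + 2) ∧ |u t| ≤ 1 + δ := by
  have hγ := h.gamma_pos
  have hLf := h.Lf_pos
  have hLg := h.Lg_pos
  have hD := h.D_nonneg
  have h0T : (0 : ℝ) ∈ Icc 0 T := ⟨le_rfl, hT.le⟩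
  set C := 2 * D + (Lg + γ) * (Lf / γ + 2) with hC
  have hC0 : 0 ≤ C := by positivity
  set Z := slidingLyapunov k a (γ / Lf) xU U W x y u with hZ
  -- B' = (C + 1)(1 + B) dominates C(1 + B) + 1. The start B(0) = 7 covers Z(0) ≤ 3 + 4, using
  -- |u(0)| ≤ 2.
  set B : ℝ → ℝ := fun t => 8 * Real.exp ((C + 1) * t) - 1 with hB
  have hBK : ∀ t ∈ Icc 0 T, B t ≤ K := fun t ht => by
    have : Real.exp ((C + 1) * t) ≤ Real.exp ((C + 1) * T) :=
      Real.exp_le_exp.2 (mul_le_mul_of_nonneg_left ht.2 (by linarith))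
    rw [hB, hK]; dsimp only; linarith
  have hbox : ∀ t ∈ Icc 0 T, Z t ≤ B t →
      ‖x t - xU t‖ ≤ a * (Lf / γ * K) ∧ |y t| ≤ a * (K + 2) := fun t ht hZB => by
    have hZK := hZB.trans (hBK t ht)
    have e1 := h.norm_sub_div_le (x := x) (y := y) (u := u) (W := W) (k := k) (t := t) ha
    have e2 := h.abs_div_le (x := x) (y := y) (u := u) ht hk hk1 ha
    rw [div_le_iff₀ ha] at e1 e2
    constructor
    · refine e1.trans ?_
      rw [mul_comm]; gcongr
    · refine e2.trans ?_
      rw [mul_comm]; gcongr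
  have hxUc : ContinuousOn xU (Icc 0 T) := fun t ht => (h.hasDeriv t ht).continuousWithinAt
  have hZc : ContinuousOn Z (Icc 0 T) := by
    have := continuousOn_of_abs_sub_le h.lip_U
    have := continuousOn_of_abs_sub_le h.lip_W
    rw [hZ]
    unfold slidingLyapunov
    fun_prop
  have hBc : ContinuousOn B (Icc 0 T) := by
    simp only [hB]; fun_prop
  have main : Icc 0 T ⊆ {t | Z t ≤ B t ∧ |u t| ≤ 1 + δ} := by
    refine IsClosed.Icc_subset_of_forall_exists_gt ?_ ?_ ?_
    · have c1 := isClosed_Icc.isClosed_le hZc hBc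
      have c2 := isClosed_Icc.isClosed_le huc.abs (continuousOn_const (c := 1 + δ))
      convert c1.inter c2 using 1
      ext t
      simp only [mem_inter_iff, mem_ofPred_eq]
      tauto
    · refine ⟨?_, hu0⟩
      have e0 : Z 0 = |u 0 - U 0| + |y 0 / a - u 0 - k * W 0| := by
        simp [hZ, slidingLyapunov, hx0]
      have e1 : B 0 = 7 := by norm_num [hB]
      rw [e0, e1]
      have b1 := h.abs_U_le 0 h0T
      have b2 : |k * W 0| ≤ 1 := by
        rw [abs_mul, abs_of_pos hk]
        exact mul_le_one₀ hk1 (abs_nonneg _) (h.abs_W_le 0 h0T)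
      have b3 : |y 0 / a| ≤ 1 := by
        rw [abs_div, abs_of_pos ha, div_le_one ha]; exact hy0.le
      have c1 := abs_sub (u 0) (U 0)
      have c2 := abs_sub (y 0 / a - u 0) (k * W 0)
      have c3 := abs_sub (y 0 / a) (u 0)
      linarith
    · rintro t ⟨⟨hZB, hut⟩, ht⟩ z hz
      have ht' := Ico_subset_Icc_self ht
      obtain ⟨b1, b2⟩ := hbox t ht' hZB
      have hxR : ‖x t‖ ≤ R := by
        have := norm_add_le (xU t) (x t - xU t)
        rw [add_sub_cancel] at this
        linarith [h.norm_add_one_le t ht']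
      have hy1 : |y t| ≤ 1 := b2.trans ha1
      obtain ⟨dx, dy, du⟩ := hode t ht hxR hy1 hut
      have ev1 := h.eventually_lyapunov_le hk hk1 hkL ha ht hxR hy1 hut dx dy du
      have ev2 := eventually_abs_le_of_hasDerivWithinAt (h.abs_switch_le _) hδ (mul_pos hk ha)
        ht hut du
      obtain ⟨v, hv1, hv2, hv3⟩ := (ev1.and (ev2.and (Ioc_mem_nhdsGT hz))).exists
      refine ⟨v, ⟨?_, hv2⟩, hv3⟩
      have hs : 0 ≤ v - t := sub_nonneg.2 hv3.1.le
      refine hv1.trans ?_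
      have hexp : Real.exp ((C + 1) * t) * ((C + 1) * (v - t) + 1) ≤
          Real.exp ((C + 1) * v) := by
        have e : (C + 1) * v = (C + 1) * t + (C + 1) * (v - t) := by ring
        rw [e, Real.exp_add]
        exact mul_le_mul_of_nonneg_left (Real.add_one_le_exp _) (Real.exp_pos _).le
      have h1t : 1 ≤ Real.exp ((C + 1) * t) :=
        Real.one_le_exp (mul_nonneg (by linarith) ht.1)
      calc Z t + (v - t) * (C * (1 + Z t) + 1)
          ≤ B t + (v - t) * (C * (1 + B t) + (8 * Real.exp ((C + 1) * t))) := by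
            gcongr
            linarith
        _ = 8 * (Real.exp ((C + 1) * t) * ((C + 1) * (v - t) + 1)) - 1 := by
            simp only [hB]; ring
        _ ≤ 8 * Real.exp ((C + 1) * v) - 1 := by linarith
  exact fun t ht => ⟨(hbox t ht (main ht).1).1, (hbox t ht (main ht).1).2, (main ht).2⟩

end

/-! ### The switch and its inverse. -/

theorem IsSmoothSwitch.eq_one_of_one_lt {φ : ℝ → ℝ} (h : IsSmoothSwitch φ) {w : ℝ} (hw : 1 < w) :
    φ w = 1 := by
  rw [h.eq_sign w (by rwa [abs_of_pos (by linarith)]), Real.sign_of_pos (by linarith)]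

theorem IsSmoothSwitch.eq_neg_one_of_lt {φ : ℝ → ℝ} (h : IsSmoothSwitch φ) {w : ℝ}
    (hw : w < -1) : φ w = -1 := by
  rw [h.eq_sign w (by rw [abs_of_neg (by linarith)]; linarith), Real.sign_of_neg (by linarith)]

/-- `eq_sign` is silent at the endpoint; the limit from the right supplies the value. -/
theorem IsSmoothSwitch.apply_one {φ : ℝ → ℝ} (h : IsSmoothSwitch φ) : φ 1 = 1 := by
  have h1 : Tendsto φ (𝓝[>] 1) (𝓝 (φ 1)) :=
    (h.smooth.continuous.tendsto 1).mono_left nhdsWithin_le_nhds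
  have h2 : Tendsto φ (𝓝[>] 1) (𝓝 1) := by
    refine tendsto_const_nhds.congr' ?_
    filter_upwards [self_mem_nhdsWithin] with w hw
    exact (h.eq_one_of_one_lt hw).symm
  exact tendsto_nhds_unique h1 h2

theorem IsSmoothSwitch.apply_neg_one {φ : ℝ → ℝ} (h : IsSmoothSwitch φ) : φ (-1) = -1 := by
  have h1 : Tendsto φ (𝓝[<] (-1)) (𝓝 (φ (-1))) :=
    (h.smooth.continuous.tendsto (-1)).mono_left nhdsWithin_le_nhds
  have h2 : Tendsto φ (𝓝[<] (-1)) (𝓝 (-1)) := by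
    refine tendsto_const_nhds.congr' ?_
    filter_upwards [self_mem_nhdsWithin] with w hw
    exact (h.eq_neg_one_of_lt hw).symm
  exact tendsto_nhds_unique h1 h2

theorem IsSmoothSwitch.abs_le_one {φ : ℝ → ℝ} (h : IsSmoothSwitch φ) (w : ℝ) : |φ w| ≤ 1 := by
  rcases le_or_gt |w| 1 with hw | hw
  · exact abs_le.2 (h.mem_Icc w hw)
  · rcases lt_abs.1 hw with hw | hw
    · simp [h.eq_one_of_one_lt hw]
    · simp [h.eq_neg_one_of_lt (w := w) (by linarith)]

theorem IsSmoothSwitch.strictMonoOn {φ : ℝ → ℝ} (h : IsSmoothSwitch φ) :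
    StrictMonoOn φ (Icc (-1) 1) := by
  refine strictMonoOn_of_deriv_pos (convex_Icc _ _) h.smooth.continuous.continuousOn ?_
  intro w hw
  rw [interior_Icc] at hw
  exact h.deriv_pos w (abs_lt.2 hw)

theorem IsSmoothSwitch.monotone {φ : ℝ → ℝ} (h : IsSmoothSwitch φ) : Monotone φ := by
  intro v w hvw
  rcases lt_or_ge 1 w with hw | hw
  · rw [h.eq_one_of_one_lt hw]; exact (abs_le.1 (h.abs_le_one v)).2
  rcases lt_or_ge v (-1) with hv | hv
  · rw [h.eq_neg_one_of_lt hv]; exact (abs_le.1 (h.abs_le_one w)).1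
  exact h.strictMonoOn.monotoneOn ⟨hv, hvw.trans hw⟩ ⟨hv.trans hvw, hw⟩ hvw

theorem IsSmoothSwitch.exists_apply_eq {φ : ℝ → ℝ} (h : IsSmoothSwitch φ) {v : ℝ}
    (hv : |v| ≤ 1) : ∃ w ∈ Icc (-1 : ℝ) 1, φ w = v := by
  have := intermediate_value_Icc (show (-1 : ℝ) ≤ 1 by norm_num) h.smooth.continuous.continuousOn
  rw [h.apply_one, h.apply_neg_one] at this
  exact this (abs_le.1 hv)

/-- On values in a compact subinterval of `(-1, 1)`, the inverse of the switch is Lipschitz. -/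
theorem IsSmoothSwitch.exists_abs_sub_le {φ : ℝ → ℝ} (h : IsSmoothSwitch φ) {b : ℝ} (hb : b < 1)
    (hb0 : 0 ≤ b) :
    ∃ C > 0, ∀ v ∈ Icc (-1 : ℝ) 1, ∀ w ∈ Icc (-1 : ℝ) 1, |φ v| ≤ b → |φ w| ≤ b →
      |v - w| ≤ C * |φ v - φ w| := by
  -- As φ(±1) = ±1 and b < 1, the preimages of ±b are interior, and between them φ' has a positive
  -- minimum.
  obtain ⟨p, hp, hpb⟩ := h.exists_apply_eq (v := b) (by rw [abs_of_nonneg hb0]; exact hb.le)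
  obtain ⟨n, hn, hnb⟩ := h.exists_apply_eq (v := -b) (by rw [abs_neg, abs_of_nonneg hb0]; exact hb.le)
  have hp1 : p < 1 := lt_of_le_of_ne hp.2 (by rintro rfl; rw [h.apply_one] at hpb; linarith)
  have hn1 : -1 < n := lt_of_le_of_ne hn.1 (by
    intro e; rw [← e, h.apply_neg_one] at hnb; linarith)
  have hnp : n ≤ p := by
    rw [← h.strictMonoOn.le_iff_le hn hp, hnb, hpb]; linarith
  have hd : Continuous (deriv φ) := h.smooth.continuous_deriv (by simp)
  obtain ⟨m, hm, hmin⟩ := isCompact_Icc.exists_isMinOn (nonempty_Icc.2 hnp) hd.continuousOn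
  have hc : 0 < deriv φ m := h.deriv_pos m (abs_lt.2 ⟨by linarith [hm.1], by linarith [hm.2]⟩)
  have hdiff : Differentiable ℝ φ := h.smooth.differentiable (by simp)
  have hmem : ∀ v ∈ Icc (-1 : ℝ) 1, |φ v| ≤ b → v ∈ Icc n p := fun v hv hvb => by
    rw [abs_le, ← hnb, ← hpb] at hvb
    exact ⟨(h.strictMonoOn.le_iff_le hn hv).1 hvb.1, (h.strictMonoOn.le_iff_le hv hp).1 hvb.2⟩
  have key : ∀ v ∈ Icc n p, ∀ w ∈ Icc n p, v ≤ w → deriv φ m * (w - v) ≤ φ w - φ v :=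
    fun v hv w hw hvw => (convex_Icc n p).mul_sub_le_image_sub_of_le_deriv
      h.smooth.continuous.continuousOn hdiff.differentiableOn
      (fun z hz => hmin (interior_subset hz)) v hv w hw hvw
  have main : ∀ v ∈ Icc n p, ∀ w ∈ Icc n p, v ≤ w →
      |v - w| ≤ (deriv φ m)⁻¹ * |φ v - φ w| := fun v hv w hw hvw => by
    have k := key v hv w hw hvw
    rw [abs_sub_comm, abs_of_nonneg (sub_nonneg.2 hvw), abs_sub_comm, inv_mul_eq_div,
      le_div_iff₀ hc, mul_comm]
    exact k.trans (le_abs_self _)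
  refine ⟨(deriv φ m)⁻¹, inv_pos.2 hc, fun v hv w hw hvb hwb => ?_⟩
  rcases le_total v w with hvw | hvw
  · exact main v (hmem v hv hvb) w (hmem w hw hwb) hvw
  · rw [abs_sub_comm, abs_sub_comm (φ v)]
    exact main w (hmem w hw hwb) v (hmem v hv hvb) hvw

/-! ### Uniform constants from compactness. -/

section

variable {E : Type*} [NormedAddCommGroup E] [NormedSpace ℝ E] [FiniteDimensional ℝ E]

/-- A `C^∞` function of `(x, y, u)` is Lipschitz on bounded boxes. -/
theorem ContDiff.exists_norm_sub_le_of_box {F : Type*} [NormedAddCommGroup F] [NormedSpace ℝ F]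
    {f : E → ℝ → ℝ → F} (hf : ContDiff ℝ ∞ (fun p : E × ℝ × ℝ => f p.1 p.2.1 p.2.2)) (R : ℝ) :
    ∃ L > 0, ∀ x x' y y' u u', ‖x‖ ≤ R → ‖x'‖ ≤ R → |y| ≤ 1 → |y'| ≤ 1 → |u| ≤ 2 → |u'| ≤ 2 →
      ‖f x y u - f x' y' u'‖ ≤ L * (‖x - x'‖ + |y - y'| + |u - u'|) := by
  have hc : Convex ℝ (Metric.closedBall (0 : E) R ×ˢ Icc (-1 : ℝ) 1 ×ˢ Icc (-2 : ℝ) 2) :=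
    (convex_closedBall _ _).prod ((convex_Icc _ _).prod (convex_Icc _ _))
  have hk : IsCompact (Metric.closedBall (0 : E) R ×ˢ Icc (-1 : ℝ) 1 ×ˢ Icc (-2 : ℝ) 2) :=
    (isCompact_closedBall _ _).prod (isCompact_Icc.prod isCompact_Icc)
  obtain ⟨K, hK⟩ := hf.contDiffOn.exists_lipschitzOnWith (by simp) hc hk
  refine ⟨K + 1, by positivity, fun x x' y y' u u' hx hx' hy hy' hu hu' => ?_⟩
  have h := hK.norm_sub_le (x := (x, y, u)) (y := (x', y', u'))
    ⟨by simpa using hx, abs_le.1 hy, abs_le.1 hu⟩ ⟨by simpa using hx', abs_le.1 hy', abs_le.1 hu'⟩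
  refine h.trans ?_
  have h2 : ‖((x, y, u) : E × ℝ × ℝ) - (x', y', u')‖ ≤ ‖x - x'‖ + |y - y'| + |u - u'| := by
    simp only [Prod.mk_sub_mk, Prod.norm_mk, Real.norm_eq_abs]
    have := norm_nonneg (x - x'); have := abs_nonneg (y - y'); have := abs_nonneg (u - u')
    refine max_le (by linarith) (max_le (by linarith) (by linarith))
  gcongr
  linarith

/-- The monotonicity of `g(x, 0, ·)` holds uniformly on a neighbourhood of `[-1, 1]`. -/
theorem IsAttractingSwitch.exists_deriv_le {g : E → ℝ → ℝ → ℝ} {M : ℝ}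
    (hM : IsAttractingSwitch g M)
    (hg : ContDiff ℝ ∞ (fun p : E × ℝ × ℝ => g p.1 p.2.1 p.2.2)) (hM0 : 0 < M) :
    ∃ δ > 0, δ ≤ 1 ∧ ∃ γ > 0, ∀ x : E, ‖x‖ ≤ M → ∀ u, |u| ≤ 1 + δ →
      deriv (fun s : ℝ => g x 0 s) u ≤ -γ := by
  have hcont : Continuous fun q : E × ℝ => deriv (fun s : ℝ => g q.1 0 s) q.2 := by
    have e : (fun q : E × ℝ => deriv (fun s : ℝ => g q.1 0 s) q.2) = fun q : E × ℝ =>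
        fderiv ℝ (fun p : E × ℝ × ℝ => g p.1 p.2.1 p.2.2) (q.1, 0, q.2) (0, 0, 1) := by
      funext q
      have h1 : HasDerivAt (fun s : ℝ => ((q.1, (0 : ℝ), s) : E × ℝ × ℝ)) (0, 0, 1) q.2 :=
        (hasDerivAt_const q.2 q.1).prodMk ((hasDerivAt_const q.2 (0 : ℝ)).prodMk (hasDerivAt_id q.2))
      have h2 := (hg.differentiable (by simp) (q.1, 0, q.2)).hasFDerivAt
      exact (h2.comp_hasDerivAt q.2 h1).deriv
    rw [e]
    exact ((hg.continuous_fderiv (by simp)).comp (by fun_prop)).clm_apply continuous_const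
  have hopen : IsOpen {q : E × ℝ | deriv (fun s : ℝ => g q.1 0 s) q.2 < 0} :=
    isOpen_lt hcont continuous_const
  obtain ⟨A, V, -, hVo, hA, hV, hAV⟩ := generalized_tube_lemma
    (isCompact_closedBall (0 : E) M) (isCompact_Icc (a := (-1 : ℝ)) (b := 1)) hopen (by
      rintro ⟨x, u⟩ ⟨hx, hu⟩
      exact (hM x (by simpa using hx)).2.2 u hu)
  obtain ⟨d1, hd1, h1⟩ := Metric.isOpen_iff.1 hVo 1 (hV ⟨by norm_num, le_rfl⟩)
  obtain ⟨d2, hd2, h2⟩ := Metric.isOpen_iff.1 hVo (-1) (hV ⟨le_rfl, by norm_num⟩)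
  -- Halving keeps |u| ≤ 1 + δ inside the open set V; the cap 1 keeps |u| ≤ 2, where the box
  -- Lipschitz bounds hold.
  set δ := min 1 (min (d1 / 2) (d2 / 2)) with hδ
  have hδ0 : 0 < δ := lt_min one_pos (lt_min (half_pos hd1) (half_pos hd2))
  have hδ1 : δ ≤ d1 / 2 := (min_le_right _ _).trans (min_le_left _ _)
  have hδ2 : δ ≤ d2 / 2 := (min_le_right _ _).trans (min_le_right _ _)
  have hneg : ∀ x : E, ‖x‖ ≤ M → ∀ u, |u| ≤ 1 + δ → deriv (fun s : ℝ => g x 0 s) u < 0 := by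
    intro x hx u hu
    have huV : u ∈ V := by
      rw [abs_le] at hu
      rcases lt_or_ge 1 u with hu1 | hu1
      · refine h1 ?_
        rw [Metric.mem_ball, Real.dist_eq, abs_of_pos (by linarith)]; linarith
      rcases lt_or_ge u (-1) with hu2 | hu2
      · refine h2 ?_
        rw [Metric.mem_ball, Real.dist_eq, abs_of_neg (by linarith)]; linarith
      exact hV ⟨hu2, hu1⟩
    exact hAV (show (x, u) ∈ A ×ˢ V from ⟨hA (by simpa using hx), huV⟩)
  obtain ⟨⟨x1, u1⟩, hm, hmax⟩ := ((isCompact_closedBall (0 : E) M).prod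
    (isCompact_Icc (a := -(1 + δ)) (b := 1 + δ))).exists_isMaxOn
    ⟨((0 : E), (0 : ℝ)), by simpa using hM0.le, by constructor <;> linarith⟩ hcont.continuousOn
  refine ⟨δ, hδ0, min_le_left _ _, -deriv (fun s : ℝ => g x1 0 s) u1,
    neg_pos.2 (hneg x1 (by simpa using hm.1) u1 (abs_le.2 hm.2)), fun x hx u hu => ?_⟩
  rw [neg_neg]
  exact hmax (show (x, u) ∈ _ from ⟨by simpa using hx, abs_le.1 hu⟩)

end

/-! ### Existence by cut-off, and construction of the reference. -/

section

variable {E : Type*} [NormedAddCommGroup E] [NormedSpace ℝ E] [FiniteDimensional ℝ E]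

/-- A smooth vector field agrees on any ball with one whose integral curves exist on `[0, T]`. -/
theorem ContDiff.exists_integralCurve_of_closedBall {v : E → E} (hv : ContDiff ℝ ∞ v) {T : ℝ}
    (hT : 0 < T) {R : ℝ} (hR : 0 < R) (x₀ : E) :
    ∃ (w : E → E) (z : ℝ → E), (∀ p, ‖p‖ ≤ R → w p = v p) ∧ z 0 = x₀ ∧
      ∀ t ∈ Icc 0 T, HasDerivWithinAt z (w (z t)) (Icc 0 T) t := by
  let χ : ContDiffBump (0 : E) := ⟨R, R + 1, hR, by linarith⟩
  have hw : ContDiff ℝ ∞ fun p => χ p • v p := χ.contDiff.smul hv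
  have hsupp : HasCompactSupport fun p => χ p • v p := χ.hasCompactSupport.smul_right
  obtain ⟨C, hC⟩ := hw.lipschitzWith_of_hasCompactSupport (𝕂 := ℝ) hsupp (by simp)
  obtain ⟨N, hN⟩ := hsupp.exists_bound_of_continuous hw.continuous
  -- The cut-off field is bounded by N, so a ball of radius NT holds the curve up to time T.
  have hpl : IsPicardLindelof (fun _ : ℝ => fun p => χ p • v p) (tmin := 0) (tmax := T)
      ⟨0, le_rfl, hT.le⟩ x₀ (N.toNNReal * T.toNNReal) 0 N.toNNReal C := by
    refine IsPicardLindelof.of_time_independent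
      (fun p _ => (hN p).trans (Real.le_coe_toNNReal N)) hC.lipschitzOnWith ?_
    simp [hT.le]
  obtain ⟨z, hz0, hz⟩ := hpl.exists_eq_forall_mem_Icc_hasDerivWithinAt₀
  refine ⟨fun p => χ p • v p, z, fun p hp => ?_, hz0, hz⟩
  dsimp only
  rw [χ.one_of_mem_closedBall (by simpa using hp), one_smul]

variable {f : E → ℝ → ℝ → E} {g : E → ℝ → ℝ → ℝ} {φ : ℝ → ℝ} {M T : ℝ} {xU : ℝ → E}

/-- Curves solving the slow-fast system wherever they lie in a given box exist on `[0, T]`. -/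
theorem exists_solution_in_box
    (hf : ContDiff ℝ ∞ (fun p : E × ℝ × ℝ => f p.1 p.2.1 p.2.2))
    (hg : ContDiff ℝ ∞ (fun p : E × ℝ × ℝ => g p.1 p.2.1 p.2.2)) (hφ : ContDiff ℝ ∞ φ)
    (hT : 0 < T) (R α ε : ℝ) (x₀ : E) (y₀ u₀ : ℝ) :
    ∃ (x : ℝ → E) (y u : ℝ → ℝ), x 0 = x₀ ∧ y 0 = y₀ ∧ u 0 = u₀ ∧
      ContinuousOn x (Icc 0 T) ∧ ContinuousOn y (Icc 0 T) ∧ ContinuousOn u (Icc 0 T) ∧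
      ∀ t ∈ Icc 0 T, ‖x t‖ ≤ R → |y t| ≤ R → |u t| ≤ R →
        HasDerivWithinAt x (f (x t) (y t) (u t)) (Icc 0 T) t ∧
        HasDerivWithinAt y (g (x t) (y t) (u t)) (Icc 0 T) t ∧
        HasDerivWithinAt u ((φ ((y t + α * u t) / ε) - u t) / ε) (Icc 0 T) t := by
  have hv : ContDiff ℝ ∞ fun p : E × ℝ × ℝ => (f p.1 p.2.1 p.2.2, g p.1 p.2.1 p.2.2,
      (φ ((p.2.1 + α * p.2.2) / ε) - p.2.2) / ε) := by
    refine hf.prodMk (hg.prodMk (ContDiff.div_const (ContDiff.sub (hφ.comp ?_) ?_) ε))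
    · fun_prop
    · fun_prop
  obtain ⟨w, z, hw, hz0, hz⟩ := hv.exists_integralCurve_of_closedBall hT
    (R := max R 1) (lt_max_of_lt_right one_pos) (x₀, y₀, u₀)
  have d1 : ∀ t ∈ Icc 0 T, HasDerivWithinAt (fun t => (z t).1) (w (z t)).1 (Icc 0 T) t :=
    fun t ht => by simpa using (hz t ht).hasFDerivWithinAt.fst.hasDerivWithinAt
  have d2 : ∀ t ∈ Icc 0 T, HasDerivWithinAt (fun t => (z t).2.1) (w (z t)).2.1 (Icc 0 T) t :=
    fun t ht => by simpa using (hz t ht).hasFDerivWithinAt.snd.fst.hasDerivWithinAt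
  have d3 : ∀ t ∈ Icc 0 T, HasDerivWithinAt (fun t => (z t).2.2) (w (z t)).2.2 (Icc 0 T) t :=
    fun t ht => by simpa using (hz t ht).hasFDerivWithinAt.snd.snd.hasDerivWithinAt
  refine ⟨fun t => (z t).1, fun t => (z t).2.1, fun t => (z t).2.2, by simp [hz0], by simp [hz0],
    by simp [hz0], fun t ht => (d1 t ht).continuousWithinAt,
    fun t ht => (d2 t ht).continuousWithinAt, fun t ht => (d3 t ht).continuousWithinAt,
    fun t ht h1 h2 h3 => ?_⟩
  have e := hw (z t) (by
    rw [Prod.norm_def, Prod.norm_def]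
    exact (max_le h1 (max_le h2 h3)).trans (le_max_left _ _))
  have d1 := d1 t ht
  have d2 := d2 t ht
  have d3 := d3 t ht
  rw [e] at d1 d2 d3
  exact ⟨d1, d2, d3⟩

/-- Utkin's equivalent control system provides a sliding reference. -/
theorem IsUtkinSolution.exists_isSlidingReference
    (hf : ContDiff ℝ ∞ (fun p : E × ℝ × ℝ => f p.1 p.2.1 p.2.2))
    (hg : ContDiff ℝ ∞ (fun p : E × ℝ × ℝ => g p.1 p.2.1 p.2.2))
    (hφ : IsSmoothSwitch φ) (hM : IsAttractingSwitch g M) (hT : 0 < T)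
    (hxU : IsUtkinSolution f g T xU) (hxUM : ∀ t ∈ Icc (0 : ℝ) T, ‖xU t‖ < M) :
    ∃ δ > 0, δ ≤ 1 ∧ ∃ (γ Lf Lg D : ℝ) (U W : ℝ → ℝ),
      IsSlidingReference f g φ T (M + 1) δ γ Lf Lg D xU U W := by
  have hM0 : 0 < M := (norm_nonneg _).trans_lt (hxUM 0 ⟨le_rfl, hT.le⟩)
  have hMle : ∀ t ∈ Icc 0 T, ‖xU t‖ ≤ M := fun t ht => (hxUM t ht).le
  obtain ⟨δ, hδ, hδ1, γ, hγ, hder⟩ := hM.exists_deriv_le hg hM0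
  obtain ⟨Lf, hLf, lipf⟩ := hf.exists_norm_sub_le_of_box (M + 1)
  obtain ⟨Lg, hLg, lipg⟩ := hg.exists_norm_sub_le_of_box (M + 1)
  simp only [Real.norm_eq_abs] at lipg
  choose! U hU using hxU
  have hU1 : ∀ t ∈ Icc 0 T, |U t| ≤ 1 := fun t ht => abs_le.2 (hU t ht).1
  have hmono : ∀ t ∈ Icc 0 T, ∀ v w, |v| ≤ 1 + δ → |w| ≤ 1 + δ → v ≤ w →
      g (xU t) 0 w - g (xU t) 0 v ≤ -γ * (w - v) := by
    intro t ht v w hv hw hvw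
    have hd : Differentiable ℝ fun s : ℝ => g (xU t) 0 s :=
      (hg.differentiable (by simp)).comp (by fun_prop : Differentiable ℝ
        fun s : ℝ => ((xU t, (0 : ℝ), s) : E × ℝ × ℝ))
    exact (convex_Icc (-(1 + δ)) (1 + δ)).image_sub_le_mul_sub_of_deriv_le
      hd.continuous.continuousOn hd.differentiableOn
      (fun s hs => hder _ (hMle t ht) s (abs_le.2 (mem_Icc.1 (interior_subset hs))))
      v (abs_le.1 hv) w (abs_le.1 hw) hvw
  have hmono' : ∀ t ∈ Icc 0 T, ∀ v w, |v| ≤ 1 + δ → |w| ≤ 1 + δ →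
      γ * |v - w| ≤ |g (xU t) 0 v - g (xU t) 0 w| := by
    intro t ht v w hv hw
    rcases le_total v w with hvw | hvw
    · have := hmono t ht v w hv hw hvw
      rw [abs_sub_comm, abs_of_nonneg (sub_nonneg.2 hvw)]
      have := le_abs_self (g (xU t) 0 v - g (xU t) 0 w)
      linarith
    · have := hmono t ht w v hw hv hvw
      rw [abs_of_nonneg (sub_nonneg.2 hvw)]
      have := neg_le_abs (g (xU t) 0 v - g (xU t) 0 w)
      linarith
  -- the sliding trajectory is Lipschitz
  obtain ⟨N, hN0, hN⟩ : ∃ N ≥ 0, ∀ t ∈ Icc 0 T, ‖f (xU t) 0 (U t)‖ ≤ N := by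
    refine ⟨‖f 0 0 0‖ + Lf * (M + 1), by positivity, fun t ht => ?_⟩
    have h1 := lipf (xU t) 0 0 0 (U t) 0 (by linarith [hMle t ht]) (by simp; linarith) (by simp)
      (by simp) (by linarith [hU1 t ht]) (by simp)
    have h2 : f (xU t) 0 (U t) = f 0 0 0 + (f (xU t) 0 (U t) - f 0 0 0) := by abel
    rw [h2]
    refine (norm_add_le _ _).trans (add_le_add le_rfl (h1.trans ?_))
    refine mul_le_mul_of_nonneg_left ?_ hLf.le
    simp only [sub_zero, abs_zero, add_zero]
    linarith [hMle t ht, hU1 t ht]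
  have hxlip : ∀ s ∈ Icc 0 T, ∀ t ∈ Icc 0 T, ‖xU s - xU t‖ ≤ N * |s - t| := fun s hs t ht =>
    (convex_Icc (0 : ℝ) T).norm_image_sub_le_of_norm_hasDerivWithin_le
      (fun t ht => (hU t ht).2.2) hN ht hs
  -- A quantitative implicit function argument: γ|U s - U t| ≤ |g(xU t, 0, U s)|, and g(xU s, 0, U
  -- s) = 0.
  have hUlip : ∀ s ∈ Icc 0 T, ∀ t ∈ Icc 0 T, |U s - U t| ≤ Lg * N / γ * |s - t| := by
    intro s hs t ht
    have h1 := hmono' t ht (U s) (U t) (by linarith [hU1 s hs]) (by linarith [hU1 t ht])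
    have h2 := lipg (xU t) (xU s) 0 0 (U s) (U s) (by linarith [hMle t ht])
      (by linarith [hMle s hs]) (by simp) (by simp) (by linarith [hU1 s hs])
      (by linarith [hU1 s hs])
    rw [(hU t ht).2.1, sub_zero] at h1
    rw [(hU s hs).2.1, sub_zero] at h2
    simp only [sub_self, abs_zero, add_zero] at h2
    have h3 := hxlip t ht s hs
    rw [abs_sub_comm] at h3
    have h4 : |U s - U t| * γ ≤ Lg * (N * |s - t|) := by
      rw [mul_comm]; exact h1.trans (h2.trans (by gcongr))
    rw [← le_div_iff₀ hγ] at h4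
    calc _ ≤ _ := h4
      _ = _ := by ring
  -- the equivalent control stays away from the ends of the interval
  obtain ⟨b, hb0, hb1, hUb⟩ : ∃ b, 0 ≤ b ∧ b < 1 ∧ ∀ t ∈ Icc 0 T, |U t| ≤ b := by
    have hUc : ContinuousOn U (Icc 0 T) := continuousOn_of_abs_sub_le hUlip
    obtain ⟨m, hm, hmax⟩ := isCompact_Icc.exists_isMaxOn (nonempty_Icc.2 hT.le) hUc.abs
    refine ⟨|U m|, abs_nonneg _, lt_of_le_of_ne (hU1 m hm) fun he => ?_, fun t ht => hmax ht⟩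
    obtain ⟨n1, n2, -⟩ := hM (xU m) (hMle m hm)
    have hz := (hU m hm).2.1
    rcases eq_or_eq_neg_of_abs_eq he with e | e <;> rw [e] at hz <;> linarith
  have hWex : ∀ t ∈ Icc 0 T, ∃ w ∈ Icc (-1 : ℝ) 1, φ w = U t := fun t ht =>
    hφ.exists_apply_eq (hU1 t ht)
  choose! W hW using hWex
  obtain ⟨C, hC, hCW⟩ := hφ.exists_abs_sub_le hb1 hb0
  refine ⟨δ, hδ, hδ1, γ, Lf, Lg, max (Lg * N / γ) (C * (Lg * N / γ)), U, W, ?_⟩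
  refine ⟨hφ.monotone, hφ.abs_le_one, hγ, hLf, hLg, le_max_of_le_left (by positivity),
    fun t ht => by linarith [hMle t ht], fun t ht => (hU t ht).2.2, hU1,
    fun t ht => abs_le.2 (hW t ht).1, fun t ht => (hW t ht).2, ?_, ?_, ?_, ?_, ?_⟩
  · intro s hs t ht
    exact (hUlip s hs t ht).trans (by gcongr; exact le_max_left _ _)
  · intro s hs t ht
    have h1 := hCW (W s) (hW s hs).1 (W t) (hW t ht).1 (by rw [(hW s hs).2]; exact hUb s hs)
      (by rw [(hW t ht).2]; exact hUb t ht)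
    rw [(hW s hs).2, (hW t ht).2] at h1
    calc |W s - W t| ≤ C * (Lg * N / γ * |s - t|) := h1.trans (by gcongr; exact hUlip s hs t ht)
      _ = C * (Lg * N / γ) * |s - t| := by ring
      _ ≤ _ := by gcongr; exact le_max_right _ _
  · intro t ht x y u hx hy hu
    simpa using lipf x (xU t) y 0 u (U t) hx (by linarith [hMle t ht]) hy (by simp)
      (by linarith) (by linarith [hU1 t ht])
  · intro t ht x y u hx hy hu
    simpa using lipg x (xU t) y 0 u u hx (by linarith [hMle t ht]) hy (by simp)
      (by linarith) (by linarith)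
  · intro t ht u hu k hk hkL
    have hUδ : |U t| ≤ 1 + δ := by linarith [hU1 t ht]
    have hl := lipg (xU t) (xU t) 0 0 u (U t) (by linarith [hMle t ht]) (by linarith [hMle t ht])
      (by simp) (by simp) (by linarith) (by linarith)
    rw [(hU t ht).2.1] at hl
    simp only [sub_self, norm_zero, abs_zero, sub_zero, zero_add] at hl
    -- Smallness of k prevents overshooting: u - U + kg keeps the sign of u - U, so the absolute
    -- values open.
    have hkl : k * |g (xU t) 0 u| ≤ |u - U t| :=
      calc k * |g (xU t) 0 u| ≤ k * (Lg * |u - U t|) := by gcongr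
        _ = k * Lg * |u - U t| := by ring
        _ ≤ 1 * |u - U t| := by gcongr
        _ = _ := one_mul _
    rcases le_total (U t) u with hle | hle
    · have h1 := hmono t ht (U t) u hUδ hu hle
      rw [(hU t ht).2.1, sub_zero] at h1
      rw [abs_of_nonneg (sub_nonneg.2 hle)] at hkl ⊢
      have h2 := mul_le_mul_of_nonneg_left (neg_abs_le (g (xU t) 0 u)) hk.le
      have h3 := mul_le_mul_of_nonneg_left h1 hk.le
      rw [abs_of_nonneg (by linarith)]
      linarith
    · have h1 := hmono t ht u (U t) hu hUδ hle
      rw [(hU t ht).2.1, zero_sub] at h1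
      rw [abs_of_nonpos (sub_nonpos.2 hle)] at hkl ⊢
      have h2 := mul_le_mul_of_nonneg_left (le_abs_self (g (xU t) 0 u)) hk.le
      have h3 := mul_le_mul_of_nonneg_left h1 hk.le
      rw [abs_of_nonpos (by linarith)]
      linarith

end

/-! ### Choice of constants and conclusion. -/

theorem theorem3p2 {E : Type*} [NormedAddCommGroup E] [NormedSpace ℝ E] [FiniteDimensional ℝ E]
    (f : E → ℝ → ℝ → E) (g : E → ℝ → ℝ → ℝ) (φ : ℝ → ℝ) (M T : ℝ) (xU : ℝ → E)
    (hf : ContDiff ℝ ∞ (fun p : E × ℝ × ℝ => f p.1 p.2.1 p.2.2))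
    (hg : ContDiff ℝ ∞ (fun p : E × ℝ × ℝ => g p.1 p.2.1 p.2.2))
    (hφ : IsSmoothSwitch φ)
    (hM : IsAttractingSwitch g M)
    (hT : 0 < T)
    (hxU : IsUtkinSolution f g T xU)
    (hxUM : ∀ t ∈ Icc (0 : ℝ) T, ‖xU t‖ < M) :
    ∃ κ₀ > (0 : ℝ), ∃ α₀ > (0 : ℝ),
      ∀ κ : ℝ, κ < 0 → |κ| ≤ κ₀ → ∀ δ₀ : ℝ, 0 < δ₀ → δ₀ ≤ |κ| * α₀ →
        ∃ L > (0 : ℝ), ∀ α : ℝ, α < 0 → |α| ≤ α₀ →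
          ∀ y₀ u₀ : ℝ, |y₀| < |α| → |(|u₀| - 1)| < δ₀ →
            (∃ (x : ℝ → E) (y u : ℝ → ℝ),
              IsSlowFastSolution f g φ α (κ * α) T x y u ∧
                x 0 = xU 0 ∧ y 0 = y₀ ∧ u 0 = u₀) ∧
            ∀ (x : ℝ → E) (y u : ℝ → ℝ),
              IsSlowFastSolution f g φ α (κ * α) T x y u →
              x 0 = xU 0 → y 0 = y₀ → u 0 = u₀ →
              ∀ t ∈ Icc (0 : ℝ) T, ‖x t - xU t‖ < L * |α| ∧ |y t| < L * |α| := by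
  have hM0 : 0 < M := (norm_nonneg _).trans_lt (hxUM 0 ⟨le_rfl, hT.le⟩)
  obtain ⟨δ, hδ, hδ1, γ, Lf, Lg, D, U, W, h⟩ :=
    hxU.exists_isSlidingReference hf hg hφ hM hT hxUM
  have hγ := h.gamma_pos
  have hLf := h.Lf_pos
  have hLg := h.Lg_pos
  set K := 8 * Real.exp ((2 * D + (Lg + γ) * (Lf / γ + 2) + 1) * T) with hK
  have hK0 : 0 < K := by positivity
  have hLK : 0 < Lf / γ * K := by positivity
  -- κ₀ serves the contraction; α₀ keeps x within distance 1 of xU and |y| ≤ 1, and with κ₀ ≤ 1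
  -- forces δ₀ ≤ δ.
  refine ⟨min 1 (1 / Lg), by positivity, min δ (min (1 / (K + 2)) (1 / (Lf / γ * K))),
    by positivity, ?_⟩
  intro κ hκ hκ0 δ₀ _ hδκ
  -- The sum of both positive bounds makes each inequality strict; it depends on neither κ nor δ₀.
  refine ⟨Lf / γ * K + (K + 2), by positivity, ?_⟩
  intro α hα hα0 y₀ u₀ hy₀ hu₀
  obtain ⟨k, rfl⟩ : ∃ k, κ = -k := ⟨-κ, by ring⟩
  obtain ⟨a, rfl⟩ : ∃ a, α = -a := ⟨-α, by ring⟩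
  have hk : 0 < k := by linarith
  have ha : 0 < a := by linarith
  rw [abs_neg, abs_of_pos hk] at hκ0 hδκ
  rw [abs_neg, abs_of_pos ha] at hα0 hy₀ ⊢
  rw [neg_mul_neg]
  obtain ⟨hk1, hkL⟩ := le_min_iff.1 hκ0
  obtain ⟨-, ha12⟩ := le_min_iff.1 hα0
  obtain ⟨ha1, ha2⟩ := le_min_iff.1 ha12
  rw [le_div_iff₀ (by positivity)] at hkL ha1 ha2
  have hu₀' : |u₀| ≤ 1 + δ := by
    have h1 : δ₀ ≤ 1 * δ :=
      hδκ.trans (mul_le_mul hk1 (min_le_left _ _) (by positivity) zero_le_one)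
    have := (abs_lt.1 hu₀).2
    linarith
  have bound : ∀ (x : ℝ → E) (y u : ℝ → ℝ), ContinuousOn x (Icc 0 T) →
      ContinuousOn y (Icc 0 T) → ContinuousOn u (Icc 0 T) →
      (∀ t ∈ Icc 0 T, ‖x t‖ ≤ M + 1 → |y t| ≤ 1 → |u t| ≤ 1 + δ →
        HasDerivWithinAt x (f (x t) (y t) (u t)) (Icc 0 T) t ∧
        HasDerivWithinAt y (g (x t) (y t) (u t)) (Icc 0 T) t ∧
        HasDerivWithinAt u ((φ ((y t + -a * u t) / (k * a)) - u t) / (k * a)) (Icc 0 T) t) →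
      x 0 = xU 0 → y 0 = y₀ → u 0 = u₀ → ∀ t ∈ Icc 0 T,
        ‖x t - xU t‖ ≤ a * (Lf / γ * K) ∧ |y t| ≤ a * (K + 2) ∧ |u t| ≤ 1 + δ := by
    intro x y u hxc hyc huc hode hx0 hy0 hu0
    refine h.apriori_bound hT hδ hδ1 hk hk1 hkL ha hK ha1 ha2 hxc hyc huc ?_ hx0
      (hy0 ▸ hy₀) (hu0 ▸ hu₀')
    intro t ht h1 h2 h3
    have := hode t (Ico_subset_Icc_self ht) h1 h2 h3
    rwa [neg_mul, ← sub_eq_add_neg] at this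
  constructor
  · obtain ⟨x, y, u, hx0, hy0, hu0, hxc, hyc, huc, hode⟩ :=
      -- The radius M + 2 exceeds all three box sizes M + 1, 1 and 1 + δ.
      exists_solution_in_box hf hg hφ.smooth hT (M + 2) (-a) (k * a) (xU 0) y₀ u₀
    have hb := bound x y u hxc hyc huc
      (fun t ht h1 h2 h3 => hode t ht (by linarith) (by linarith) (by linarith)) hx0 hy0 hu0
    have hsol := fun t (ht : t ∈ Icc 0 T) => hode t ht
      (by
        have h1 := norm_add_le (xU t) (x t - xU t)
        rw [add_sub_cancel] at h1
        linarith [(hb t ht).1, hxUM t ht])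
      (by linarith [(hb t ht).2.1]) (by linarith [(hb t ht).2.2])
    exact ⟨x, y, u, ⟨fun t ht => (hsol t ht).1, fun t ht => (hsol t ht).2.1,
      fun t ht => (hsol t ht).2.2⟩, hx0, hy0, hu0⟩
  · intro x y u hs hx0 hy0 hu0 t ht
    obtain ⟨b1, b2, -⟩ := bound x y u (fun t ht => (hs.hasDeriv_x t ht).continuousWithinAt)
      (fun t ht => (hs.hasDeriv_y t ht).continuousWithinAt)
      (fun t ht => (hs.hasDeriv_u t ht).continuousWithinAt)
      (fun t ht _ _ _ => ⟨hs.hasDeriv_x t ht, hs.hasDeriv_y t ht, hs.hasDeriv_u t ht⟩)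
      hx0 hy0 hu0 t ht
    have p1 : 0 < a * (Lf / γ * K) := by positivity
    have p2 : 0 < a * (K + 2) := by positivity
    constructor <;> linarith
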